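/- \textbf{Model.} Let $\varphi:\mathbb R\to[0,\infty)$ be non-decreasing with $\varphi(x)\to 0$ as $x\to-\infty$ and $\varphi(x)\to\infty$ as $x\to\infty$, and either strictly positive everywhere, or zero below some level and strictly increasing from that level on; put $\varphi(-\infty)=0$. Let $c>0$, $\alpha>0$, $k\ge 0$. On a probability space let $\Pi$ be a Poisson field of intensity $1$ on $(0,\infty)^2$ and let $(Z_n)_{n\ge1}$ be i.i.d. positive random variables with finite mean, independent of $\Pi$. A \emph{solution} with initial value $(X_0,Y_0)\in[-\infty,\infty)\times[0,\infty)$, where $(X_0,Y_0)$ is independent of $(\Pi,(Z_n))$, is a locally finite point process $N$ on $(0,\infty)$ such that almost surely, for all $t\ge 0$, with $N(t)=N((0,t])$, $$X(t)=X_0+ct-\sum_{n=1}^{N(t)}Z_n,\qquad Y(t)=Y_0e^{-\alpha t}+k\int_{(0,t]}e^{-\alpha(t-s)}\,N(ds),$$ $$\lambda(t)=\varphi(X(t))+Y(t),\qquad N(t)=\int_{(0,t]}\int_{(0,\infty)}\mathbf 1\{z\le\lambda(s-)\}\,\Pi(ds\times dz).$$ The solution is a \emph{stationary ergodic version} of the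 model if the process $(X(t),Y(t))_{t\ge0}$ is stationary and every event of its path space that is almost surely invariant under all time shifts has probability $0$ or $1$. Its mean intensity is $\lambda=E[\lambda(t)]\in[0,\infty]$, which does not depend on $t$. \textbf{Statement.} (i) If the model admits a stationary ergodic version with $0<\lambda<\infty$, then $k/\alpha<1$. (ii) If $k/\alpha>1$ (supercritical case) or $k/\alpha=1$ (critical case), then the only stationary ergodic version with $\lambda<\infty$ is the trivial one, with no events: every such version satisfies $\lambda=0$ and, almost surely, $N((0,\infty))=0$ and $X(t)=-\infty$, $Y(t)=0$ for all $t\ge0$; and conversely $X_0=-\infty$, $Y_0=0$, $N=0$ is a stationary ergodic version. In particular there is none with $\lambda<\infty$ and $X_0$ real-valued. -/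

import Mathlib

open MeasureTheory ProbabilityTheory Filter Topology Set
open scoped ENNReal NNReal

noncomputable section

/-- The deterministic ingredients of the model: the rate function `φ` of the primary shocks, the
strain build-up rate `c`, and the constants `k`, `α` of the aftershock intensity `k e^{-α t}`. -/
structure ShockModel where
  φ : ℝ → ℝ
  c : ℝ
  k : ℝ
  α : ℝ
  φ_nonneg : ∀ x, 0 ≤ φ x
  φ_mono : Monotone φ
  φ_atBot : Tendsto φ atBot (𝓝 0)
  φ_atTop : Tendsto φ atTop atTop
  φ_shape : (∀ x, 0 < φ x) ∨ ∃ l, (∀ x < l, φ x = 0) ∧ StrictMonoOn φ (Ici l)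
  c_pos : 0 < c
  k_nonneg : 0 ≤ k
  α_pos : 0 < α

/-- `ξ` is a Poisson field of intensity `1` in the open positive quadrant: a random locally finite
integer-valued measure whose values on measurable sets of finite intensity are Poisson distributed
and whose values on pairwise disjoint measurable sets are independent. -/
structure IsPoissonField {Ω : Type*} [MeasurableSpace Ω] (P : Measure Ω)
    (ξ : Ω → Measure (ℝ × ℝ)) : Prop where
  measurable : Measurable ξ
  integer_valued : ∀ ω, ∀ B : Set (ℝ × ℝ), MeasurableSet B → Bornology.IsBounded B →
    ∃ n : ℕ, ξ ω B = n
  law : ∀ B : Set (ℝ × ℝ), MeasurableSet B → volume (B ∩ Ioi 0 ×ˢ Ioi 0) < ∞ →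
    P.map (fun ω => ξ ω B) =
      (poissonMeasure (volume (B ∩ Ioi 0 ×ˢ Ioi 0)).toNNReal).map (fun n : ℕ => (n : ℝ≥0∞))
  indep : ∀ (n : ℕ) (B : Fin n → Set (ℝ × ℝ)), (∀ i, MeasurableSet (B i)) →
    Pairwise (fun i j => Disjoint (B i) (B j)) → iIndepFun (fun i ω => ξ ω (B i)) P

/-- The probabilistic basis: a Poisson field `ξ` and, independent of it, an i.i.d. sequence of
positive random variables with finite mean. `Z n` is the strain released by the `(n+1)`-st event. -/
structure IsDrivingBasis {Ω : Type*} [MeasurableSpace Ω] (P : Measure Ω)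
    (ξ : Ω → Measure (ℝ × ℝ)) (Z : ℕ → Ω → ℝ) : Prop where
  poisson : IsPoissonField P ξ
  Z_measurable : ∀ n, Measurable (Z n)
  Z_pos : ∀ n, ∀ᵐ ω ∂P, 0 < Z n ω
  Z_indep : iIndepFun Z P
  Z_identDistrib : ∀ n, IdentDistrib (Z n) (Z 0) P P
  Z_integrable : Integrable (Z 0) P
  indep : IndepFun ξ (fun ω n => Z n ω) P

namespace ShockModel

/-- The function `φ` extended to the states in `[-∞, ∞)` by `φ(-∞) = 0`. -/
def rate (M : ShockModel) (x : EReal) : ℝ :=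
  if x = ⊥ then 0 else M.φ x.toReal

/-- `N(t)`, the number of events in `(0, t]`, for an integer-valued random measure `N`. -/
def count {Ω : Type*} (N : Ω → Measure ℝ) (t : ℝ) (ω : Ω) : ℕ :=
  ⌊(N ω (Ioc 0 t)).toReal⌋₊

/-- `X(t) = X₀ + c t - ∑_{n=1}^{N(t)} Z_n`; it is `-∞` for all `t` when `X₀ = -∞`. -/
def X (M : ShockModel) {Ω : Type*} (Z : ℕ → Ω → ℝ) (X₀ : Ω → EReal) (N : Ω → Measure ℝ)
    (t : ℝ) (ω : Ω) : EReal :=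
  X₀ ω + ((M.c * t - ∑ n ∈ Finset.range (count N t ω), Z n ω : ℝ) : EReal)

/-- `Y(t) = Y₀ e^{-α t} + k ∫_{(0,t]} e^{-α (t-s)} N(ds)`. -/
def Y (M : ShockModel) {Ω : Type*} (Y₀ : Ω → ℝ) (N : Ω → Measure ℝ) (t : ℝ) (ω : Ω) : ℝ :=
  Y₀ ω * Real.exp (-M.α * t) + M.k * ∫ s in Ioc 0 t, Real.exp (-M.α * (t - s)) ∂(N ω)

/-- The stochastic intensity `λ(t) = φ(X(t)) + Y(t)`. -/
def intensity (M : ShockModel) {Ω : Type*} (Z : ℕ → Ω → ℝ) (X₀ : Ω → EReal) (Y₀ : Ω → ℝ)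
    (N : Ω → Measure ℝ) (t : ℝ) (ω : Ω) : ℝ :=
  M.rate (M.X Z X₀ N t ω) + M.Y Y₀ N t ω

/-- `N` is the point process of the model with initial value `(X₀, Y₀)`, driven by `ξ` and `Z`: the
initial value lies in `[-∞, ∞) × [0, ∞)` and is independent of the driving basis, and
`N(t) = ∫_{(0,t]} ∫ 1(z ≤ λ(s-)) ξ(ds × dz)` for all `t ≥ 0`. -/
structure IsSolution (M : ShockModel) {Ω : Type*} [MeasurableSpace Ω] (P : Measure Ω)
    (ξ : Ω → Measure (ℝ × ℝ)) (Z : ℕ → Ω → ℝ) (X₀ : Ω → EReal) (Y₀ : Ω → ℝ)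
    (N : Ω → Measure ℝ) : Prop where
  X₀_measurable : Measurable X₀
  Y₀_measurable : Measurable Y₀
  X₀_lt_top : ∀ᵐ ω ∂P, X₀ ω < ⊤
  Y₀_nonneg : ∀ᵐ ω ∂P, 0 ≤ Y₀ ω
  initial_indep : IndepFun (fun ω => (X₀ ω, Y₀ ω)) (fun ω => (ξ ω, fun n => Z n ω)) P
  N_measurable : Measurable N
  N_integer_valued : ∀ ω t, ∃ n : ℕ, N ω (Ioc 0 t) = n
  N_eq : ∀ᵐ ω ∂P, ∀ t : ℝ, 0 ≤ t →
    N ω (Ioc 0 t) = ξ ω {p | p.1 ∈ Ioc 0 t ∧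
      p.2 ∈ Ioc 0 (Function.leftLim (fun s => M.intensity Z X₀ Y₀ N s ω) p.1)}

/-- The path `(X(h + t), Y(h + t))`, `t ≥ 0`, of the state process shifted by `h`. -/
def path (M : ShockModel) {Ω : Type*} (Z : ℕ → Ω → ℝ) (X₀ : Ω → EReal) (Y₀ : Ω → ℝ)
    (N : Ω → Measure ℝ) (h : ℝ≥0) (ω : Ω) : ℝ≥0 → EReal × ℝ :=
  fun t => (M.X Z X₀ N (h + t) ω, M.Y Y₀ N (h + t) ω)

/-- A stationary ergodic version of the model: a solution whose state process `(X(t), Y(t))`,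
`t ≥ 0`, is stationary, and such that every event of the path space that is almost surely
invariant under all shifts has probability `0` or `1`. -/
structure IsStationaryErgodic (M : ShockModel) {Ω : Type*} [MeasurableSpace Ω] (P : Measure Ω)
    (ξ : Ω → Measure (ℝ × ℝ)) (Z : ℕ → Ω → ℝ) (X₀ : Ω → EReal) (Y₀ : Ω → ℝ)
    (N : Ω → Measure ℝ) : Prop where
  solution : M.IsSolution P ξ Z X₀ Y₀ N
  stationary : ∀ h : ℝ≥0, IdentDistrib (M.path Z X₀ Y₀ N h) (M.path Z X₀ Y₀ N 0) P P
  ergodic : ∀ A : Set (ℝ≥0 → EReal × ℝ), MeasurableSet A →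
    (∀ h : ℝ≥0, M.path Z X₀ Y₀ N h ⁻¹' A =ᵐ[P] M.path Z X₀ Y₀ N 0 ⁻¹' A) →
    P (M.path Z X₀ Y₀ N 0 ⁻¹' A) = 0 ∨ P (M.path Z X₀ Y₀ N 0 ⁻¹' A) = 1

/-- The mean intensity `E[λ(0)] ∈ [0, ∞]`, which for a stationary version is `E[λ(t)]` for all
`t ≥ 0`. -/
def meanIntensity (M : ShockModel) {Ω : Type*} [MeasurableSpace Ω] (P : Measure Ω)
    (Z : ℕ → Ω → ℝ) (X₀ : Ω → EReal) (Y₀ : Ω → ℝ) (N : Ω → Measure ℝ) : ℝ≥0∞ :=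
  ∫⁻ ω, ENNReal.ofReal (M.intensity Z X₀ Y₀ N 0 ω) ∂P

end ShockModel

end

/-!
A stationary version with finite mean intensity and `k ≥ α` has no events. The reason is a drift
inequality for a strictly convex function of `Y`.

Let `λ₀ = φ(X₀) + Y₀` and `f(y) = y + e^{-y}`, which is nondecreasing on `[0, ∞)`, strictly convex
and of linear growth, so that `E f(Y₀)` is finite. The generator of `(X, Y)` maps `f(Y)` to
`λ (f(Y + k) - f(Y)) - α Y f'(Y)`, whose mean vanishes in the stationary regime; only the inequality
`E[λ₀ (f(Y₀ + k) - f(Y₀))] ≤ E[α Y₀ f'(Y₀)]` is needed (`lintegral_drift_le`). As `k ≥ α`, strict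
convexity gives `λ₀ (f(Y₀ + k) - f(Y₀)) ≥ Y₀ k f'(Y₀) ≥ α Y₀ f'(Y₀)`, strictly where `λ₀ > 0`.
Hence `λ₀ = 0` almost surely (`initial_eq_zero`), in the critical and supercritical cases alike.

For the inequality neither the adaptedness of `N` nor a compensator formula is required. Before the
first event the intensity is at least `λ₀ e^{-α h}` on `(0, h]`, so a point of the Poisson field in
`(0, h] × (0, λ₀ e^{-α h}]` forces an event in `(0, h]` (`event_of_rect`), and an event raises `Y(h)`
to at least `(Y₀ + k) e^{-α h}`. The height of this rectangle depends on the initial value only,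
which is independent of the field, so the probability of a point is explicit
(`lintegral_mul_indicator_rect`). Comparing `E f(Y(h)) = E f(Y₀)` with this lower bound, dividing by
`h` and applying Fatou's lemma as `h → 0` gives the drift inequality.

Once `λ₀ = 0`, stationarity gives `Y(n) = 0` for all `n`, which excludes events because `k > 0`.
Then `X(t) = X₀ + c t` has the law of `X₀` for every `t`, and `c > 0` forces `X₀ = -∞`
(`ae_eq_bot_of_identDistrib_add`).
-/

/-! ### The convex test function -/

/-- The test function `y ↦ y + e^{-y}`: nonnegative, strictly convex, nondecreasing and of linear
growth on `[0, ∞)`. -/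
noncomputable def convexTest (y : ℝ) : ℝ := y + Real.exp (-y)

lemma continuous_convexTest : Continuous convexTest := by
  unfold convexTest; fun_prop

lemma convexTest_nonneg {y : ℝ} (hy : 0 ≤ y) : 0 ≤ convexTest y :=
  add_nonneg hy (Real.exp_pos _).le

lemma convexTest_sub_le (x y : ℝ) :
    convexTest y - convexTest x ≤ (1 - Real.exp (-y)) * (y - x) := by
  have h : Real.exp (-x) = Real.exp (-y) * Real.exp (y - x) := by
    rw [← Real.exp_add]; congr 1; ring
  have h1 := mul_le_mul_of_nonneg_left (Real.add_one_le_exp (y - x)) (Real.exp_pos (-y)).le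
  unfold convexTest
  rw [h]
  nlinarith

lemma convexTest_mono {x y : ℝ} (hx : 0 ≤ x) (hxy : x ≤ y) : convexTest x ≤ convexTest y := by
  have h := convexTest_sub_le y x
  have h1 : Real.exp (-x) ≤ 1 := Real.exp_le_one_iff.2 (by linarith)
  nlinarith [mul_nonneg (sub_nonneg.2 h1) (sub_nonneg.2 hxy)]

lemma lt_convexTest_add_sub {k : ℝ} (hk : 0 < k) (y : ℝ) :
    k * (1 - Real.exp (-y)) < convexTest (y + k) - convexTest y := by
  have h : Real.exp (-(y + k)) = Real.exp (-y) * Real.exp (-k) := by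
    rw [← Real.exp_add]; congr 1; ring
  have h1 : -k + 1 < Real.exp (-k) := Real.add_one_lt_exp (by linarith)
  have h2 := mul_lt_mul_of_pos_left h1 (Real.exp_pos (-y))
  unfold convexTest
  rw [h]
  nlinarith

/-! ### Elementary estimates -/

lemma le_leftLim_of_forall_Ioc {g : ℝ → ℝ} {h L p : ℝ} (hg : ∀ s ∈ Ioc 0 h, L ≤ g s)
    (hp : p ∈ Ioc 0 h) : L ≤ Function.leftLim g p := by
  by_cases hlim : ∃ y, Tendsto g (𝓝[<] p) (𝓝 y)
  · refine ge_of_tendsto (tendsto_leftLim_of_tendsto hlim) ?_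
    filter_upwards [Ioo_mem_nhdsLT hp.1] with s hs
    exact hg s ⟨hs.1, hs.2.le.trans hp.2⟩
  · rw [leftLim_eq_of_not_tendsto _ hlim]
    exact hg p hp

/-- The Poisson mass `h * L`, with `L` the largest multiple of the mesh `h` not above `l e^{-a h}`,
hits with probability at least `h` times a function of `h` that tends to `l` as `h → 0`. -/
lemma le_one_sub_exp_floor {a h l : ℝ} (ha : 0 ≤ a) (hh : 0 < h) (hl : 0 ≤ l) :
    h * ((l * Real.exp (-a * h) - h) * Real.exp (-(h * l))) ≤
      1 - Real.exp (-(h * (⌊l * Real.exp (-a * h) / h⌋₊ * h))) := by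
  set L : ℝ := ⌊l * Real.exp (-a * h) / h⌋₊ * h with hL
  have hL0 : 0 ≤ L := by positivity
  have he : Real.exp (-a * h) ≤ 1 := Real.exp_le_one_iff.2 (by nlinarith)
  have hle : L ≤ l * Real.exp (-a * h) := by
    have := Nat.floor_le (a := l * Real.exp (-a * h) / h) (by positivity)
    rwa [le_div_iff₀ hh] at this
  have hlt : l * Real.exp (-a * h) - h ≤ L := by
    have := Nat.lt_floor_add_one (l * Real.exp (-a * h) / h)
    rw [div_lt_iff₀ hh] at this
    linarith
  have hLl : L ≤ l := hle.trans (by nlinarith)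
  have h1 : h * L * Real.exp (-(h * L)) ≤ 1 - Real.exp (-(h * L)) := by
    have h2 := mul_le_mul_of_nonneg_right (Real.add_one_le_exp (h * L))
      (Real.exp_pos (-(h * L))).le
    rw [← Real.exp_add, add_neg_cancel, Real.exp_zero] at h2
    linarith
  refine le_trans ?_ h1
  rw [mul_assoc]
  refine mul_le_mul_of_nonneg_left ?_ hh.le
  calc (l * Real.exp (-a * h) - h) * Real.exp (-(h * l))
      ≤ L * Real.exp (-(h * l)) := mul_le_mul_of_nonneg_right hlt (Real.exp_pos _).le
    _ ≤ L * Real.exp (-(h * L)) := by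
        refine mul_le_mul_of_nonneg_left (Real.exp_le_exp.2 ?_) hL0
        nlinarith

/-! ### Void probabilities of the Poisson field -/

section Poisson

variable {Ω : Type*} [MeasurableSpace Ω] {P : Measure Ω} [IsProbabilityMeasure P]
  {ξ : Ω → Measure (ℝ × ℝ)}

lemma IsPoissonField.measure_rect_ne_zero (hξ : IsPoissonField P ξ) {h l : ℝ} (hh : 0 ≤ h)
    (hl : 0 ≤ l) :
    P {ω | ξ ω (Ioc 0 h ×ˢ Ioc 0 l) ≠ 0} = ENNReal.ofReal (1 - Real.exp (-(h * l))) := by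
  have hB : MeasurableSet (Ioc (0 : ℝ) h ×ˢ Ioc (0 : ℝ) l) :=
    measurableSet_Ioc.prod measurableSet_Ioc
  have hinter : (Ioc (0 : ℝ) h ×ˢ Ioc (0 : ℝ) l) ∩ Ioi 0 ×ˢ Ioi 0 = Ioc 0 h ×ˢ Ioc 0 l :=
    inter_eq_left.2 (prod_mono Ioc_subset_Ioi_self Ioc_subset_Ioi_self)
  have hvol : volume (Ioc (0 : ℝ) h ×ˢ Ioc (0 : ℝ) l) = ENNReal.ofReal (h * l) := by
    rw [Measure.volume_eq_prod, Measure.prod_prod, Real.volume_Ioc, Real.volume_Ioc, sub_zero,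
      sub_zero, ENNReal.ofReal_mul hh]
  have hmeas : Measurable fun ω => ξ ω (Ioc 0 h ×ˢ Ioc 0 l) :=
    (Measure.measurable_coe hB).comp hξ.measurable
  have hlaw := hξ.law _ hB (by rw [hinter, hvol]; exact ENNReal.ofReal_lt_top)
  have h0 : P {ω | ξ ω (Ioc 0 h ×ˢ Ioc 0 l) = 0} = ENNReal.ofReal (Real.exp (-(h * l))) := by
    have h1 := congrArg (fun μ : Measure ℝ≥0∞ => μ {0}) hlaw
    rw [Measure.map_apply hmeas (measurableSet_singleton _),
      Measure.map_apply (measurable_from_top) (measurableSet_singleton _), hinter, hvol] at h1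
    have h2 : (fun n : ℕ => (n : ℝ≥0∞)) ⁻¹' {0} = {0} := by ext n; simp
    rw [h2, poissonMeasure_singleton] at h1
    simp only [pow_zero, Nat.factorial_zero, Nat.cast_one, mul_one, div_one] at h1
    have h3 : (((ENNReal.ofReal (h * l)).toNNReal : ℝ≥0) : ℝ) = h * l := by
      rw [ENNReal.coe_toNNReal_eq_toReal, ENNReal.toReal_ofReal (mul_nonneg hh hl)]
    rw [h3] at h1
    exact h1
  have hc : {ω | ξ ω (Ioc 0 h ×ˢ Ioc 0 l) ≠ 0} = {ω | ξ ω (Ioc 0 h ×ˢ Ioc 0 l) = 0}ᶜ := rfl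
  have hms : MeasurableSet {ω | ξ ω (Ioc 0 h ×ˢ Ioc 0 l) = 0} := hmeas (measurableSet_singleton 0)
  rw [hc, prob_compl_eq_one_sub hms, h0,
    ENNReal.ofReal_sub _ (Real.exp_pos _).le, ENNReal.ofReal_one]

/-- The probability that the field charges a rectangle of random height, averaged against a weight,
when height and weight depend only on a variable `W` independent of the field. The height takes
countably many values, so that independence is used for one rectangle at a time. -/
lemma IsPoissonField.lintegral_mul_indicator_rect (hξ : IsPoissonField P ξ) {β : Type*}
    [MeasurableSpace β] {W : Ω → β} (hW : Measurable W) (hind : IndepFun W ξ P)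
    {d : β → ℝ≥0∞} (hd : Measurable d) {j : β → ℕ} (hj : Measurable j) {h : ℝ} (hh : 0 ≤ h) :
    ∫⁻ ω, d (W ω) * {ω | ξ ω (Ioc 0 h ×ˢ Ioc 0 (j (W ω) * h)) ≠ 0}.indicator 1 ω ∂P =
      ∫⁻ ω, d (W ω) * ENNReal.ofReal (1 - Real.exp (-(h * (j (W ω) * h)))) ∂P := by
  classical
  set d' : ℕ → β → ℝ≥0∞ := fun i => (j ⁻¹' {i}).indicator d with hd'_def
  have hd' : ∀ i, Measurable (d' i) := fun i => hd.indicator (hj (measurableSet_singleton i))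
  set R : ℕ → Set (ℝ × ℝ) := fun i => Ioc 0 h ×ˢ Ioc 0 (i * h) with hR
  set C : ℕ → Set (Measure (ℝ × ℝ)) := fun i => {m | m (R i) ≠ 0} with hC_def
  have hC : ∀ i, MeasurableSet (C i) := fun i =>
    (Measure.measurable_coe (measurableSet_Ioc.prod measurableSet_Ioc)
      (measurableSet_singleton 0)).compl
  set e : ℕ → Measure (ℝ × ℝ) → ℝ≥0∞ := fun i => (C i).indicator 1 with he_def
  have he : ∀ i, Measurable (e i) := fun i => measurable_one.indicator (hC i)
  have hsum : ∀ (g : ℕ → ℝ≥0∞) (ω : Ω),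
      ∑' i, d' i (W ω) * g i = d (W ω) * g (j (W ω)) := by
    intro g ω
    rw [tsum_eq_single (j (W ω))]
    · simp [hd'_def]
    · intro i hi
      have : W ω ∉ j ⁻¹' {i} := fun hmem => hi (by simpa using hmem.symm)
      simp [hd'_def, indicator_of_notMem this]
  calc ∫⁻ ω, d (W ω) * {ω | ξ ω (Ioc 0 h ×ˢ Ioc 0 (j (W ω) * h)) ≠ 0}.indicator 1 ω ∂P
      = ∫⁻ ω, ∑' i, d' i (W ω) * e i (ξ ω) ∂P := by
        refine lintegral_congr fun ω => ?_
        rw [hsum (fun i => e i (ξ ω)) ω]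
        rfl
    _ = ∑' i, ∫⁻ ω, d' i (W ω) * e i (ξ ω) ∂P :=
        lintegral_tsum fun i =>
          (((hd' i).comp hW).mul ((he i).comp hξ.measurable)).aemeasurable
    _ = ∑' i : ℕ, ∫⁻ ω, d' i (W ω) * ENNReal.ofReal (1 - Real.exp (-(h * (i * h)))) ∂P := by
        congr 1
        ext i
        have hprod := lintegral_mul_eq_lintegral_mul_lintegral_of_indepFun
          ((hd' i).comp hW) ((he i).comp hξ.measurable) (hind.comp (hd' i) (he i))
        have hprob : ∫⁻ ω, (e i ∘ ξ) ω ∂P = ENNReal.ofReal (1 - Real.exp (-(h * (i * h)))) := by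
          rw [← hξ.measure_rect_ne_zero hh (by positivity : (0 : ℝ) ≤ i * h)]
          exact lintegral_indicator_one (hξ.measurable (hC i))
        rw [hprob] at hprod
        exact hprod.trans (lintegral_mul_const _ ((hd' i).comp hW)).symm
    _ = ∫⁻ ω, ∑' i : ℕ, d' i (W ω) * ENNReal.ofReal (1 - Real.exp (-(h * (i * h)))) ∂P :=
        (lintegral_tsum fun i => (((hd' i).comp hW).mul_const _).aemeasurable).symm
    _ = ∫⁻ ω, d (W ω) * ENNReal.ofReal (1 - Real.exp (-(h * (j (W ω) * h)))) ∂P :=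
        lintegral_congr fun ω =>
          hsum (fun i : ℕ => ENNReal.ofReal (1 - Real.exp (-(h * (i * h))))) ω

end Poisson

namespace ShockModel

/-! ### The state process on a single path -/

section Path

variable {Ω : Type*} (M : ShockModel) {ξ : Ω → Measure (ℝ × ℝ)} (Z : ℕ → Ω → ℝ)
  (X₀ : Ω → EReal) (Y₀ : Ω → ℝ) (N : Ω → Measure ℝ)

lemma rate_nonneg (x : EReal) : 0 ≤ M.rate x := by
  unfold rate
  split_ifs
  exacts [le_rfl, M.φ_nonneg _]

lemma measurable_rate : Measurable M.rate :=
  Measurable.ite (measurableSet_singleton _) measurable_const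
    (M.φ_mono.measurable.comp measurable_ereal_toReal)

lemma rate_le_rate_add {x : EReal} (hx : x < ⊤) {s : ℝ} (hs : 0 ≤ s) :
    M.rate x ≤ M.rate (x + (s : EReal)) := by
  induction x with
  | bot => simp
  | coe x =>
    rw [← EReal.coe_add]
    simp only [rate, EReal.coe_ne_bot, if_false, EReal.toReal_coe]
    exact M.φ_mono (by linarith)
  | top => exact absurd hx (lt_irrefl _)

variable {N} in
lemma count_eq_zero {s h : ℝ} {ω : Ω} (h0 : N ω (Ioc 0 h) = 0) (hs : s ≤ h) :
    count N s ω = 0 := by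
  simp [count, measure_mono_null (Ioc_subset_Ioc_right hs) h0]

variable {N} in
lemma X_eq_of_no_event {s h : ℝ} {ω : Ω} (h0 : N ω (Ioc 0 h) = 0) (hs : s ≤ h) :
    M.X Z X₀ N s ω = X₀ ω + ((M.c * s : ℝ) : EReal) := by
  simp [X, count_eq_zero h0 hs]

variable {N} in
lemma Y_eq_of_no_event {s h : ℝ} {ω : Ω} (h0 : N ω (Ioc 0 h) = 0) (hs : s ≤ h) :
    M.Y Y₀ N s ω = Y₀ ω * Real.exp (-M.α * s) := by
  have : (N ω).restrict (Ioc 0 s) = 0 :=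
    Measure.restrict_eq_zero.2 (measure_mono_null (Ioc_subset_Ioc_right hs) h0)
  simp [Y, this]

lemma X_zero (ω : Ω) : M.X Z X₀ N 0 ω = X₀ ω := by
  rw [M.X_eq_of_no_event Z X₀ (h := 0) (by simp) le_rfl]
  simp

lemma Y_zero (ω : Ω) : M.Y Y₀ N 0 ω = Y₀ ω := by
  rw [M.Y_eq_of_no_event Y₀ (h := 0) (by simp) le_rfl]
  simp

lemma intensity_zero (ω : Ω) : M.intensity Z X₀ Y₀ N 0 ω = M.rate (X₀ ω) + Y₀ ω := by
  rw [intensity, X_zero, Y_zero]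

lemma le_Y {h : ℝ} {ω : Ω} : Y₀ ω * Real.exp (-M.α * h) ≤ M.Y Y₀ N h ω :=
  le_add_of_nonneg_right <|
    mul_nonneg M.k_nonneg (integral_nonneg fun _ => (Real.exp_pos _).le)

variable {N} in
lemma exp_mul_le_integral {h : ℝ} {ω : Ω} (hfin : N ω (Ioc 0 h) ≠ ∞) :
    Real.exp (-M.α * h) * (N ω (Ioc 0 h)).toReal ≤
      ∫ s in Ioc 0 h, Real.exp (-M.α * (h - s)) ∂(N ω) := by
  have : IsFiniteMeasure ((N ω).restrict (Ioc 0 h)) :=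
    ⟨by rw [Measure.restrict_apply_univ]; exact hfin.lt_top⟩
  have hα := M.α_pos
  have hint : IntegrableOn (fun s => Real.exp (-M.α * (h - s))) (Ioc 0 h) (N ω) := by
    refine Integrable.of_bound (C := 1)
      (by fun_prop : Continuous fun s => Real.exp (-M.α * (h - s))).aestronglyMeasurable ?_
    filter_upwards [ae_restrict_mem measurableSet_Ioc] with s hs
    rw [Real.norm_eq_abs, Real.abs_exp, Real.exp_le_one_iff]
    nlinarith [mul_nonneg hα.le (sub_nonneg.2 hs.2)]
  have h1 : ∫ _ in Ioc 0 h, Real.exp (-M.α * h) ∂(N ω) =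
      Real.exp (-M.α * h) * (N ω (Ioc 0 h)).toReal := by
    simp [Measure.real, mul_comm]
  rw [← h1]
  refine setIntegral_mono_on (integrable_const _) hint measurableSet_Ioc fun s hs => ?_
  refine Real.exp_le_exp.2 ?_
  nlinarith [mul_pos hα hs.1]

variable {N} in
lemma add_le_Y {h : ℝ} {ω : Ω} (hN : ∃ n : ℕ, N ω (Ioc 0 h) = n) (h0 : N ω (Ioc 0 h) ≠ 0) :
    (Y₀ ω + M.k) * Real.exp (-M.α * h) ≤ M.Y Y₀ N h ω := by
  obtain ⟨n, hn⟩ := hN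
  have h1 := M.exp_mul_le_integral (N := N) (h := h) (ω := ω) (by simp [hn])
  have h2 : (1 : ℝ) ≤ (N ω (Ioc 0 h)).toReal := by
    rw [hn] at h0 ⊢
    rw [ENNReal.toReal_natCast]
    exact_mod_cast Nat.one_le_iff_ne_zero.2 (by simpa using h0)
  have h3 := mul_le_mul_of_nonneg_left
    ((le_mul_of_one_le_right (Real.exp_pos (-M.α * h)).le h2).trans h1) M.k_nonneg
  unfold Y
  linarith

variable {N} in
/-- Before the first event the intensity decays at most by the factor `e^{-α h}`, so a point of the
field in the rectangle `(0, h] × (0, L]` either is an event or comes after one. -/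
lemma event_of_rect {h L : ℝ} {ω : Ω} (hX : X₀ ω < ⊤) (hY : 0 ≤ Y₀ ω)
    (hN : N ω (Ioc 0 h) = ξ ω {p | p.1 ∈ Ioc 0 h ∧
      p.2 ∈ Ioc 0 (Function.leftLim (fun s => M.intensity Z X₀ Y₀ N s ω) p.1)})
    (hL : L ≤ (M.rate (X₀ ω) + Y₀ ω) * Real.exp (-M.α * h))
    (hrect : ξ ω (Ioc 0 h ×ˢ Ioc 0 L) ≠ 0) : N ω (Ioc 0 h) ≠ 0 := by
  intro h0
  refine hrect (measure_mono_null ?_ (hN ▸ h0))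
  intro p hp
  refine ⟨hp.1, hp.2.1, hp.2.2.trans (le_leftLim_of_forall_Ioc (fun s hs => ?_) hp.1)⟩
  rw [intensity, M.X_eq_of_no_event Z X₀ h0 hs.2, M.Y_eq_of_no_event Y₀ h0 hs.2]
  have hα := M.α_pos
  have he : Real.exp (-M.α * h) ≤ Real.exp (-M.α * s) := by
    refine Real.exp_le_exp.2 ?_
    nlinarith [mul_nonneg hα.le (sub_nonneg.2 hs.2)]
  have he1 : Real.exp (-M.α * h) ≤ 1 :=
    he.trans (Real.exp_le_one_iff.2 (by nlinarith [mul_pos hα hs.1]))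
  have h1 := M.rate_le_rate_add hX (mul_nonneg M.c_pos.le hs.1.le)
  have h2 := mul_le_of_le_one_right (M.rate_nonneg (X₀ ω)) he1
  have h3 := mul_le_mul_of_nonneg_left he hY
  linarith

variable {N} in
lemma no_event_of_Y_eq_zero (hk : 0 < M.k) {h : ℝ} {ω : Ω} (hY : 0 ≤ Y₀ ω)
    (hN : ∃ n : ℕ, N ω (Ioc 0 h) = n) (h0 : M.Y Y₀ N h ω = 0) : N ω (Ioc 0 h) = 0 := by
  by_contra hne
  have h1 := M.add_le_Y Y₀ hN hne
  rw [h0] at h1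
  have := mul_pos (add_pos_of_nonneg_of_pos hY hk) (Real.exp_pos (-M.α * h))
  linarith

end Path

/-! ### Stationarity and the mean of the test function -/

section Stationary

variable {Ω : Type*} [MeasurableSpace Ω] {P : Measure Ω} {M : ShockModel}
  {ξ : Ω → Measure (ℝ × ℝ)} {Z : ℕ → Ω → ℝ} {X₀ : Ω → EReal} {Y₀ : Ω → ℝ} {N : Ω → Measure ℝ}

lemma IsStationaryErgodic.identDistrib_state (hS : M.IsStationaryErgodic P ξ Z X₀ Y₀ N) {t : ℝ}
    (ht : 0 ≤ t) :
    IdentDistrib (fun ω => (M.X Z X₀ N t ω, M.Y Y₀ N t ω)) (fun ω => (X₀ ω, Y₀ ω)) P P := by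
  lift t to ℝ≥0 using ht
  have h := (hS.stationary t).comp (measurable_pi_apply (0 : ℝ≥0))
  convert! h using 1
  · ext ω <;> simp only [path, Function.comp_apply, NNReal.coe_zero, add_zero]
  · ext ω <;> simp [path, X_zero, Y_zero]

lemma lintegral_Y₀_lt_top (hfin : M.meanIntensity P Z X₀ Y₀ N < ∞) :
    ∫⁻ ω, ENNReal.ofReal (Y₀ ω) ∂P < ∞ := by
  refine (lintegral_mono fun ω => ENNReal.ofReal_le_ofReal ?_).trans_lt hfin
  rw [intensity_zero]
  exact le_add_of_nonneg_left (M.rate_nonneg _)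

variable [IsProbabilityMeasure P]

/-- Over `(0, h]` the mean of the test function of `Y` is constant by stationarity: the gain from a
possible first event is at most the loss from the exponential decay. -/
lemma IsStationaryErgodic.lintegral_gain_le (hbasis : IsDrivingBasis P ξ Z)
    (hS : M.IsStationaryErgodic P ξ Z X₀ Y₀ N) (hY : ∫⁻ ω, ENNReal.ofReal (Y₀ ω) ∂P < ∞)
    {h : ℝ} (hh : 0 < h) :
    ∫⁻ ω, ENNReal.ofReal (((M.rate (X₀ ω) + Y₀ ω) * Real.exp (-M.α * h) - h) *
        Real.exp (-(h * (M.rate (X₀ ω) + Y₀ ω))) *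
        (convexTest ((Y₀ ω + M.k) * Real.exp (-M.α * h)) -
          convexTest (Y₀ ω * Real.exp (-M.α * h)))) ∂P ≤
      ∫⁻ ω, ENNReal.ofReal (M.α * (Y₀ ω * (1 - Real.exp (-Y₀ ω)))) ∂P := by
  have hsol := hS.solution
  have hα := M.α_pos
  have hf := continuous_convexTest.measurable
  set E : ℝ := Real.exp (-M.α * h) with hE
  have hE0 : 0 < E := Real.exp_pos _
  have hE1 : 1 - E ≤ h * M.α := by
    have := Real.add_one_le_exp (-M.α * h)
    rw [← hE] at this
    linarith
  have hEle : E ≤ 1 := Real.exp_le_one_iff.2 (by nlinarith)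
  set W : Ω → EReal × ℝ := fun ω => (X₀ ω, Y₀ ω)
  have hW : Measurable W := hsol.X₀_measurable.prodMk hsol.Y₀_measurable
  have hind : IndepFun W ξ P := hsol.initial_indep.comp measurable_id measurable_fst
  set d : EReal × ℝ → ℝ≥0∞ := fun w =>
    ENNReal.ofReal (convexTest ((w.2 + M.k) * E) - convexTest (w.2 * E)) with hd_def
  have hd : Measurable d := by
    refine ENNReal.measurable_ofReal.comp ((hf.comp ?_).sub (hf.comp ?_)) <;> fun_prop
  set j : EReal × ℝ → ℕ := fun w => ⌊(M.rate w.1 + w.2) * E / h⌋₊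
  have hj : Measurable j := Nat.measurable_floor.comp
    ((((M.measurable_rate.comp measurable_fst).add measurable_snd).mul_const _).div_const _)
  set B : Set Ω := {ω | ξ ω (Ioc 0 h ×ˢ Ioc 0 (j (W ω) * h)) ≠ 0}
  have hF : Measurable fun ω => ENNReal.ofReal (convexTest (Y₀ ω * E)) :=
    ENNReal.measurable_ofReal.comp (hf.comp (hsol.Y₀_measurable.mul_const _))
  have hpath : ∀ᵐ ω ∂P, ENNReal.ofReal (convexTest (Y₀ ω * E)) + d (W ω) * B.indicator 1 ω ≤
      ENNReal.ofReal (convexTest (M.Y Y₀ N h ω)) := by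
    filter_upwards [hsol.X₀_lt_top, hsol.Y₀_nonneg, hsol.N_eq] with ω hX hY0 hN
    have hYE : 0 ≤ Y₀ ω * E := mul_nonneg hY0 hE0.le
    by_cases hB : ω ∈ B
    · have hle : Y₀ ω * E ≤ (Y₀ ω + M.k) * E :=
        mul_le_mul_of_nonneg_right (le_add_of_nonneg_right M.k_nonneg) hE0.le
      have hL : (j (W ω) : ℝ) * h ≤ (M.rate (X₀ ω) + Y₀ ω) * E := by
        rw [← le_div_iff₀ hh]
        refine Nat.floor_le (div_nonneg (mul_nonneg ?_ hE0.le) hh.le)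
        exact add_nonneg (M.rate_nonneg _) hY0
      have hev := M.event_of_rect Z X₀ Y₀ hX hY0 (hN h hh.le) hL hB
      rw [indicator_of_mem hB, Pi.one_apply, mul_one,
        ← ENNReal.ofReal_add (convexTest_nonneg hYE) (sub_nonneg.2 (convexTest_mono hYE hle))]
      refine ENNReal.ofReal_le_ofReal ?_
      rw [add_sub_cancel]
      exact convexTest_mono (hYE.trans hle) (M.add_le_Y Y₀ (hsol.N_integer_valued ω h) hev)
    · rw [indicator_of_notMem hB, mul_zero, add_zero]
      exact ENNReal.ofReal_le_ofReal (convexTest_mono hYE (M.le_Y Y₀ N))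
  have hdecay : ∀ᵐ ω ∂P, ENNReal.ofReal (convexTest (Y₀ ω)) ≤
      ENNReal.ofReal (convexTest (Y₀ ω * E)) +
        ENNReal.ofReal h * ENNReal.ofReal (M.α * (Y₀ ω * (1 - Real.exp (-Y₀ ω)))) := by
    filter_upwards [hsol.Y₀_nonneg] with ω hY0
    have hexp : 0 ≤ Y₀ ω * (1 - Real.exp (-Y₀ ω)) :=
      mul_nonneg hY0 (sub_nonneg.2 (Real.exp_le_one_iff.2 (by linarith)))
    rw [← ENNReal.ofReal_mul hh.le, ← ENNReal.ofReal_add (convexTest_nonneg (by positivity))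
      (by positivity)]
    refine ENNReal.ofReal_le_ofReal ?_
    have h1 := convexTest_sub_le (Y₀ ω * E) (Y₀ ω)
    have h2 := mul_le_mul_of_nonneg_right hE1 hexp
    linarith
  have hstat : ∫⁻ ω, ENNReal.ofReal (convexTest (M.Y Y₀ N h ω)) ∂P =
      ∫⁻ ω, ENNReal.ofReal (convexTest (Y₀ ω)) ∂P :=
    ((hS.identDistrib_state hh.le).comp
      (ENNReal.measurable_ofReal.comp (hf.comp measurable_snd))).lintegral_eq
  have hFfin : ∫⁻ ω, ENNReal.ofReal (convexTest (Y₀ ω * E)) ∂P ≠ ∞ := by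
    have hle : ∫⁻ ω, ENNReal.ofReal (convexTest (Y₀ ω * E)) ∂P ≤
        ∫⁻ ω, (ENNReal.ofReal (Y₀ ω) + 1) ∂P := by
      refine lintegral_mono_ae ?_
      filter_upwards [hsol.Y₀_nonneg] with ω hY0
      rw [← ENNReal.ofReal_one, ← ENNReal.ofReal_add hY0 zero_le_one]
      refine ENNReal.ofReal_le_ofReal (add_le_add (mul_le_of_le_one_right hY0 hEle) ?_)
      exact Real.exp_le_one_iff.2 (neg_nonpos.2 (mul_nonneg hY0 hE0.le))
    refine (hle.trans_lt ?_).ne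
    rw [lintegral_add_right _ measurable_const]
    simpa using hY
  have hbalance : ∫⁻ ω, d (W ω) * B.indicator 1 ω ∂P ≤
      ENNReal.ofReal h * ∫⁻ ω, ENNReal.ofReal (M.α * (Y₀ ω * (1 - Real.exp (-Y₀ ω)))) ∂P := by
    refine (ENNReal.add_le_add_iff_left hFfin).1 ?_
    rw [← lintegral_add_left hF, ← lintegral_const_mul' _ _ ENNReal.ofReal_ne_top,
      ← lintegral_add_left hF]
    exact (lintegral_mono_ae hpath).trans (hstat.trans_le (lintegral_mono_ae hdecay))
  rw [hbasis.poisson.lintegral_mul_indicator_rect hW hind hd hj hh.le] at hbalance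
  have hh' : ENNReal.ofReal h ≠ 0 := by simpa using hh
  refine (ENNReal.mul_le_mul_iff_right hh' ENNReal.ofReal_ne_top).1 (le_trans ?_ hbalance)
  rw [← lintegral_const_mul' _ _ ENNReal.ofReal_ne_top]
  refine lintegral_mono_ae ?_
  filter_upwards [hsol.Y₀_nonneg] with ω hY0
  have hdiff : 0 ≤ convexTest ((Y₀ ω + M.k) * E) - convexTest (Y₀ ω * E) :=
    sub_nonneg.2 (convexTest_mono (mul_nonneg hY0 hE0.le)
      (mul_le_mul_of_nonneg_right (le_add_of_nonneg_right M.k_nonneg) hE0.le))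
  have hrate : 0 ≤ M.rate (X₀ ω) + Y₀ ω := add_nonneg (M.rate_nonneg _) hY0
  rw [← ENNReal.ofReal_mul hh.le, hd_def, ← ENNReal.ofReal_mul hdiff]
  refine ENNReal.ofReal_le_ofReal ?_
  have h1 := mul_le_mul_of_nonneg_left (le_one_sub_exp_floor hα.le hh hrate) hdiff
  refine le_trans (le_of_eq ?_) h1
  ring

/-- The limit `h → 0` of the balance over `(0, h]`. -/
lemma IsStationaryErgodic.lintegral_drift_le (hbasis : IsDrivingBasis P ξ Z)
    (hS : M.IsStationaryErgodic P ξ Z X₀ Y₀ N) (hY : ∫⁻ ω, ENNReal.ofReal (Y₀ ω) ∂P < ∞) :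
    ∫⁻ ω, ENNReal.ofReal ((M.rate (X₀ ω) + Y₀ ω) *
        (convexTest (Y₀ ω + M.k) - convexTest (Y₀ ω))) ∂P ≤
      ∫⁻ ω, ENNReal.ofReal (M.α * (Y₀ ω * (1 - Real.exp (-Y₀ ω)))) ∂P := by
  have hf := continuous_convexTest
  set G : ℝ → Ω → ℝ≥0∞ := fun h ω =>
    ENNReal.ofReal (((M.rate (X₀ ω) + Y₀ ω) * Real.exp (-M.α * h) - h) *
      Real.exp (-(h * (M.rate (X₀ ω) + Y₀ ω))) *
      (convexTest ((Y₀ ω + M.k) * Real.exp (-M.α * h)) -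
        convexTest (Y₀ ω * Real.exp (-M.α * h)))) with hG
  set u : ℕ → ℝ := fun n => 1 / ((n : ℝ) + 1)
  have hu : Tendsto u atTop (𝓝 0) := tendsto_one_div_add_atTop_nhds_zero_nat
  have hmeas : ∀ n, Measurable (G (u n)) := by
    intro n
    have hr : Measurable fun ω => M.rate (X₀ ω) := M.measurable_rate.comp hS.solution.X₀_measurable
    have hy := hS.solution.Y₀_measurable
    have hf' := hf.measurable
    refine ENNReal.measurable_ofReal.comp (Measurable.mul ?_ ((hf'.comp ?_).sub (hf'.comp ?_))) <;>
      fun_prop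
  have hlim : ∀ ω, Tendsto (fun n => G (u n) ω) atTop
      (𝓝 (ENNReal.ofReal ((M.rate (X₀ ω) + Y₀ ω) *
        (convexTest (Y₀ ω + M.k) - convexTest (Y₀ ω))))) := by
    intro ω
    have hc : Continuous fun h => G h ω := by
      refine ENNReal.continuous_ofReal.comp (Continuous.mul ?_ ((hf.comp ?_).sub (hf.comp ?_))) <;>
        fun_prop
    have := (hc.tendsto 0).comp hu
    simpa [hG, Function.comp_def] using this
  calc _ = ∫⁻ ω, liminf (fun n => G (u n) ω) atTop ∂P :=
        lintegral_congr fun ω => (hlim ω).liminf_eq.symm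
    _ ≤ liminf (fun n => ∫⁻ ω, G (u n) ω ∂P) atTop := lintegral_liminf_le hmeas
    _ ≤ _ := by
        refine liminf_le_of_le (by isBoundedDefault) fun b hb => ?_
        obtain ⟨n, hn⟩ := hb.exists
        exact hn.trans (hS.lintegral_gain_le hbasis hY (by positivity))

/-- Gain and loss have the same finite mean although the gain dominates the loss pointwise, hence
they agree almost surely; strict convexity of the test function then leaves no intensity. -/
lemma IsStationaryErgodic.initial_eq_zero (hbasis : IsDrivingBasis P ξ Z)
    (hS : M.IsStationaryErgodic P ξ Z X₀ Y₀ N) (hY : ∫⁻ ω, ENNReal.ofReal (Y₀ ω) ∂P < ∞)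
    (hk : M.α ≤ M.k) : ∀ᵐ ω ∂P, M.rate (X₀ ω) = 0 ∧ Y₀ ω = 0 := by
  have hα := M.α_pos
  have hkpos := hα.trans_le hk
  have hf := continuous_convexTest.measurable
  have hr : Measurable fun ω => M.rate (X₀ ω) := M.measurable_rate.comp hS.solution.X₀_measurable
  have hy := hS.solution.Y₀_measurable
  have hexp : ∀ᵐ ω ∂P, 0 ≤ Y₀ ω ∧ 0 ≤ 1 - Real.exp (-Y₀ ω) := by
    filter_upwards [hS.solution.Y₀_nonneg] with ω hY0
    exact ⟨hY0, sub_nonneg.2 (Real.exp_le_one_iff.2 (by linarith))⟩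
  have hle : (fun ω => ENNReal.ofReal (M.α * (Y₀ ω * (1 - Real.exp (-Y₀ ω))))) ≤ᵐ[P]
      fun ω => ENNReal.ofReal ((M.rate (X₀ ω) + Y₀ ω) *
        (convexTest (Y₀ ω + M.k) - convexTest (Y₀ ω))) := by
    filter_upwards [hexp] with ω ⟨hY0, he⟩
    refine ENNReal.ofReal_le_ofReal ?_
    have h1 := (lt_convexTest_add_sub hkpos (Y₀ ω)).le
    have h2 : 0 ≤ M.k * (1 - Real.exp (-Y₀ ω)) := mul_nonneg hkpos.le he
    have h3 := mul_nonneg (M.rate_nonneg (X₀ ω)) (h2.trans h1)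
    have h4 := mul_le_mul_of_nonneg_left h1 hY0
    have h5 := mul_le_mul_of_nonneg_right hk (mul_nonneg hY0 he)
    linarith
  have hfin : ∫⁻ ω, ENNReal.ofReal (M.α * (Y₀ ω * (1 - Real.exp (-Y₀ ω)))) ∂P ≠ ∞ := by
    have h1 : ∫⁻ ω, ENNReal.ofReal (M.α * (Y₀ ω * (1 - Real.exp (-Y₀ ω)))) ∂P ≤
        ∫⁻ ω, ENNReal.ofReal M.α * ENNReal.ofReal (Y₀ ω) ∂P := by
      refine lintegral_mono_ae ?_
      filter_upwards [hexp] with ω ⟨hY0, _⟩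
      rw [← ENNReal.ofReal_mul hα.le]
      refine ENNReal.ofReal_le_ofReal (mul_le_mul_of_nonneg_left ?_ hα.le)
      exact mul_le_of_le_one_right hY0 (sub_le_self _ (Real.exp_pos _).le)
    rw [lintegral_const_mul' _ _ ENNReal.ofReal_ne_top] at h1
    exact (h1.trans_lt (ENNReal.mul_lt_top ENNReal.ofReal_lt_top hY)).ne
  have hmeas : Measurable fun ω => ENNReal.ofReal ((M.rate (X₀ ω) + Y₀ ω) *
      (convexTest (Y₀ ω + M.k) - convexTest (Y₀ ω))) :=
    ENNReal.measurable_ofReal.comp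
      ((hr.add hy).mul ((hf.comp (hy.add_const _)).sub (hf.comp hy)))
  have heq := ae_eq_of_ae_le_of_lintegral_le hle hfin hmeas.aemeasurable
    (hS.lintegral_drift_le hbasis hY)
  filter_upwards [hexp, heq] with ω ⟨hY0, he⟩ h
  have hlt := lt_convexTest_add_sub hkpos (Y₀ ω)
  have h2 : 0 ≤ M.k * (1 - Real.exp (-Y₀ ω)) := mul_nonneg hkpos.le he
  have hrate := M.rate_nonneg (X₀ ω)
  rw [ENNReal.ofReal_eq_ofReal_iff (by positivity)
    (mul_nonneg (add_nonneg hrate hY0) (h2.trans hlt.le))] at h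
  -- The gain dominates the loss with a strictly positive margin per unit of intensity.
  have h5 := mul_le_mul_of_nonneg_right hk (mul_nonneg hY0 he)
  have hzero : M.rate (X₀ ω) + Y₀ ω = 0 := by
    by_contra hne
    have hpos : 0 < M.rate (X₀ ω) + Y₀ ω := lt_of_le_of_ne (add_nonneg hrate hY0) (Ne.symm hne)
    have h6 := mul_lt_mul_of_pos_left hlt hpos
    have h7 := mul_nonneg hrate h2
    linarith
  constructor <;> linarith

/-! ### Versions without intensity -/

/-- A random variable with values in `[-∞, ∞)` whose law is invariant under the translations
by `c n`, `n ∈ ℕ`, for some `c > 0`, is almost surely `-∞`. -/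
lemma ae_eq_bot_of_identDistrib_add {U : Ω → EReal} (hU : Measurable U) (hlt : ∀ᵐ ω ∂P, U ω < ⊤)
    {c : ℝ} (hc : 0 < c)
    (hid : ∀ n : ℕ, IdentDistrib (fun ω => U ω + ((c * n : ℝ) : EReal)) U P P) :
    ∀ᵐ ω ∂P, U ω = ⊥ := by
  have hstep : ∀ a : ℝ, P {ω | U ω ≠ ⊥ ∧ U ω ≤ a} = 0 := by
    intro a
    have hanti : Tendsto (fun n : ℕ => P (U ⁻¹' Iic ((a - c * n : ℝ) : EReal))) atTop
        (𝓝 (P (⋂ n : ℕ, U ⁻¹' Iic ((a - c * n : ℝ) : EReal)))) := by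
      refine tendsto_measure_iInter_atTop
        (fun n => (hU measurableSet_Iic).nullMeasurableSet) ?_ ⟨0, measure_ne_top _ _⟩
      intro m n hmn
      refine preimage_mono (Iic_subset_Iic.2 (EReal.coe_le_coe_iff.2 ?_))
      have : (m : ℝ) ≤ n := by exact_mod_cast hmn
      nlinarith
    have hconst : ∀ n : ℕ, P (U ⁻¹' Iic ((a - c * n : ℝ) : EReal)) = P (U ⁻¹' Iic (a : EReal)) := by
      intro n
      rw [← (hid n).measure_mem_eq (measurableSet_Iic (a := (a : EReal)))]
      congr 1
      ext ω
      simp only [mem_preimage, mem_Iic]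
      generalize U ω = x
      induction x with
      | bot => simp
      | coe x => rw [← EReal.coe_add, EReal.coe_le_coe_iff, EReal.coe_le_coe_iff, le_sub_iff_add_le]
      | top =>
        rw [EReal.top_add_coe]
        simp only [top_le_iff, EReal.coe_ne_top]
    have hinter : (⋂ n : ℕ, U ⁻¹' Iic ((a - c * n : ℝ) : EReal)) = U ⁻¹' {⊥} := by
      ext ω
      simp only [mem_iInter, mem_preimage, mem_Iic, mem_singleton_iff]
      refine ⟨fun h => ?_, fun h n => by simp [h]⟩
      generalize U ω = x at h
      induction x with
      | bot => rfl
      | coe x =>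
        obtain ⟨n, hn⟩ := exists_nat_gt ((a - x) / c)
        rw [div_lt_iff₀ hc] at hn
        have := EReal.coe_le_coe_iff.1 (h n)
        linarith
      | top => exact absurd (h 0) (by simp)
    simp only [hconst] at hanti
    have heq := tendsto_nhds_unique hanti tendsto_const_nhds
    rw [hinter] at heq
    have hdiff : {ω | U ω ≠ ⊥ ∧ U ω ≤ a} = U ⁻¹' Iic (a : EReal) \ U ⁻¹' {⊥} := by
      ext ω
      simp [and_comm]
    rw [hdiff, measure_sdiff (preimage_mono (by simp))
      (hU (measurableSet_singleton _)).nullMeasurableSet (measure_ne_top _ _), heq, tsub_self]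
  have hall : ∀ᵐ ω ∂P, ∀ n : ℕ, ¬(U ω ≠ ⊥ ∧ U ω ≤ ((n : ℝ) : EReal)) :=
    ae_all_iff.2 fun n => measure_eq_zero_iff_ae_notMem.1 (hstep n)
  filter_upwards [hlt, hall] with ω h1 h2
  generalize U ω = x at h1 h2
  induction x with
  | bot => rfl
  | coe x =>
    obtain ⟨n, hn⟩ := exists_nat_ge x
    exact absurd ⟨EReal.coe_ne_bot x, EReal.coe_le_coe_iff.2 hn⟩ (h2 n)
  | top => exact absurd h1 (lt_irrefl _)

lemma IsStationaryErgodic.trivial_of_le (hbasis : IsDrivingBasis P ξ Z)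
    (hS : M.IsStationaryErgodic P ξ Z X₀ Y₀ N) (hfin : M.meanIntensity P Z X₀ Y₀ N < ∞)
    (hk : M.α ≤ M.k) :
    M.meanIntensity P Z X₀ Y₀ N = 0 ∧
      ∀ᵐ ω ∂P, N ω (Ioi 0) = 0 ∧ ∀ t : ℝ, 0 ≤ t → M.X Z X₀ N t ω = ⊥ ∧ M.Y Y₀ N t ω = 0 := by
  have hkpos := M.α_pos.trans_le hk
  have hsol := hS.solution
  have hzero := hS.initial_eq_zero hbasis (lintegral_Y₀_lt_top hfin) hk
  have hY : ∀ n : ℕ, ∀ᵐ ω ∂P, M.Y Y₀ N n ω = 0 := by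
    intro n
    have hid := (hS.identDistrib_state n.cast_nonneg).comp measurable_snd
    exact hid.symm.ae_snd (p := fun y => y = 0) (measurableSet_singleton 0)
      (hzero.mono fun ω h => h.2)
  have hN : ∀ᵐ ω ∂P, ∀ n : ℕ, N ω (Ioc 0 n) = 0 := by
    filter_upwards [hsol.Y₀_nonneg, ae_all_iff.2 hY] with ω hY0 hYn n
    exact M.no_event_of_Y_eq_zero Y₀ hkpos hY0 (hsol.N_integer_valued ω n) (hYn n)
  have hX : ∀ᵐ ω ∂P, X₀ ω = ⊥ := by
    refine ae_eq_bot_of_identDistrib_add hsol.X₀_measurable hsol.X₀_lt_top M.c_pos fun n => ?_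
    have hid := (hS.identDistrib_state n.cast_nonneg).comp measurable_fst
    refine (IdentDistrib.of_ae_eq ?_ ?_).trans hid
    · exact (hsol.X₀_measurable.add_const _).aemeasurable
    · filter_upwards [hN] with ω h
      exact (M.X_eq_of_no_event Z X₀ (h n) le_rfl).symm
  constructor
  · rw [meanIntensity, lintegral_congr_ae (g := 0), lintegral_zero_fun]
    filter_upwards [hzero] with ω h
    simp [intensity_zero, h]
  · filter_upwards [hN, hX, hzero] with ω h1 h2 h3
    refine ⟨?_, fun t _ => ?_⟩
    · have hU : Ioi (0 : ℝ) = ⋃ n : ℕ, Ioc 0 (n : ℝ) := by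
        ext x
        simp only [mem_Ioi, mem_iUnion, mem_Ioc]
        exact ⟨fun hx => (exists_nat_ge x).imp fun n hn => ⟨hx, hn⟩, fun ⟨_, hx, _⟩ => hx⟩
      rw [hU]
      exact measure_iUnion_null h1
    · obtain ⟨n, hn⟩ := exists_nat_ge t
      rw [M.X_eq_of_no_event Z X₀ (h1 n) hn, M.Y_eq_of_no_event Y₀ (h1 n) hn, h2, h3.2]
      simp

lemma isStationaryErgodic_trivial (M : ShockModel) (ξ : Ω → Measure (ℝ × ℝ)) (Z : ℕ → Ω → ℝ) :
    M.IsStationaryErgodic P ξ Z (fun _ => ⊥) (fun _ => 0) (fun _ => 0) := by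
  have hX : ∀ t ω, M.X Z (fun _ : Ω => (⊥ : EReal)) (fun _ => 0) t ω = ⊥ := by simp [X]
  have hY : ∀ t ω, M.Y (fun _ : Ω => (0 : ℝ)) (fun _ => 0) t ω = 0 := by simp [Y]
  have hpath : ∀ h : ℝ≥0, M.path Z (fun _ : Ω => (⊥ : EReal)) (fun _ => 0) (fun _ => 0) h =
      fun _ _ => (⊥, 0) := by
    intro h
    ext ω t <;> simp [path, hX, hY]
  refine ⟨⟨measurable_const, measurable_const, by simp, by simp, indepFun_const_left _ _,
    measurable_const, fun ω t => ⟨0, by simp⟩, Eventually.of_forall fun ω t _ => ?_⟩, ?_, ?_⟩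
  · have hint : (fun s => M.intensity Z (fun _ : Ω => (⊥ : EReal)) (fun _ => 0) (fun _ => 0) s ω) =
        fun _ => 0 := by
      ext s
      simp [intensity, hX, hY, rate]
    have hleft : ∀ p : ℝ, Function.leftLim (fun _ : ℝ => (0 : ℝ)) p = 0 := fun p =>
      continuousWithinAt_const.leftLim_eq
    simp [hint, hleft]
  · intro h
    rw [hpath, hpath]
    exact IdentDistrib.refl measurable_const.aemeasurable
  · intro A _ _
    rw [hpath]
    by_cases hA : (fun _ : ℝ≥0 => ((⊥ : EReal), (0 : ℝ))) ∈ A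
    · right; simp [hA]
    · left; simp [hA]

end Stationary

end ShockModel


theorem mainTheorem4 {Ω : Type*} [MeasurableSpace Ω] (P : Measure Ω) [IsProbabilityMeasure P]
    (M : ShockModel) (ξ : Ω → Measure (ℝ × ℝ)) (Z : ℕ → Ω → ℝ) (hbasis : IsDrivingBasis P ξ Z) :
    (∀ (X₀ : Ω → EReal) (Y₀ : Ω → ℝ) (N : Ω → Measure ℝ),
      M.IsStationaryErgodic P ξ Z X₀ Y₀ N →
      0 < M.meanIntensity P Z X₀ Y₀ N → M.meanIntensity P Z X₀ Y₀ N < ∞ →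
      M.k / M.α < 1) ∧
    ((1 < M.k / M.α ∨ M.k / M.α = 1) →
      (∀ (X₀ : Ω → EReal) (Y₀ : Ω → ℝ) (N : Ω → Measure ℝ),
        M.IsStationaryErgodic P ξ Z X₀ Y₀ N → M.meanIntensity P Z X₀ Y₀ N < ∞ →
        M.meanIntensity P Z X₀ Y₀ N = 0 ∧
        ∀ᵐ ω ∂P, N ω (Ioi 0) = 0 ∧
          ∀ t : ℝ, 0 ≤ t → M.X Z X₀ N t ω = ⊥ ∧ M.Y Y₀ N t ω = 0) ∧
      M.IsStationaryErgodic P ξ Z (fun _ => ⊥) (fun _ => 0) (fun _ => 0)) := by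
  constructor
  · intro X₀ Y₀ N hS hpos hfin
    by_contra hk
    have hk' := (one_le_div M.α_pos).1 (not_lt.1 hk)
    exact hpos.ne' (hS.trivial_of_le hbasis hfin hk').1
  · intro hk
    have hk' : M.α ≤ M.k := (one_le_div M.α_pos).1 (hk.elim le_of_lt ge_of_eq)
    exact ⟨fun X₀ Y₀ N hS hfin => hS.trivial_of_le hbasis hfin hk',
      ShockModel.isStationaryErgodic_trivial M ξ Z⟩
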